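/- Let $n\ge 0$, $[m]=\{1,\dots,m\}$, and let $\mathfrak S_m$ be the set of permutations of $[m]$, written as words $\sigma(1)\cdots\sigma(m)$. **Laguerre histories.** For a word $\mathbf s=s_1\cdots s_n$ on $\{U,D,L_b,L_r\}$ let $h_i(\mathbf s)$ be the number of letters $U$ minus the number of letters $D$ in $s_1\cdots s_i$ (so $h_0(\mathbf s)=0$). $\mathcal{LH}_n$ is the set of pairs $(\mathbf s,\mathbf p)$ where $h_i(\mathbf s)\ge 0$ for all $i$, $h_n(\mathbf s)=0$, and $\mathbf p=(p_1,\dots,p_n)$ consists of integers with $0\le p_i\le h_{i-1}(\mathbf s)$. **The map $\psi_{FV}$.** For $\sigma\in\mathfrak S_{n+1}$ put $\sigma(0)=\sigma(n+2)=0$. Then $\psi_{FV}(\sigma)=(\mathbf s,\mathbf p)$, where for $i\in[n]$, with $i=\sigma(k)$: $s_i=U$ if $\sigma(k-1)>i<\sigma(k+1)$; $s_i=D$ if $\sigma(k-1)<i>\sigma(k+1)$; $s_i=L_b$ if $\sigma(k-1)<i<\sigma(k+1)$; $s_i=L_r$ if $\sigma(k-1)>i>\sigma(k+1)$; and $p_i$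 is the number of $j$ with $k<j<n+1$ and $\sigma(j)<i<\sigma(j+1)$. **The map $\psi_{YZL}$.** For $\sigma\in\mathfrak S_{n+1}$, $\psi_{YZL}(\sigma)=(\mathbf s,\mathbf p)$, where for $i\in[n]$: $s_i=U$ if $i<\sigma(i)$ and $i+1\le\sigma^{-1}(i+1)$; $s_i=D$ if $i\ge\sigma(i)$ and $i+1>\sigma^{-1}(i+1)$; $s_i=L_b$ if $i<\sigma(i)$ and $i+1>\sigma^{-1}(i+1)$; $s_i=L_r$ if $i\ge\sigma(i)$ and $i+1\le\sigma^{-1}(i+1)$; and $$p_i=\mathsf{nest}_i\,\sigma=\#\{j:\ j<i<\sigma(i)<\sigma(j)\ \text{ or }\ \sigma(j)<\sigma(i)\le i<j\}.$$ **The map $\Psi$.** For $\rho\in\mathfrak S_m$ and a letter $x=\rho(k)$ let $(2\text{-}31)_x\rho$ be the number of $j$ with $k<j<m$ and $\rho(j+1)<x<\rho(j)$. If $\rho(i)>\rho(i+1)$ with $1\le i<m$, call $\rho(i)$ a descent top and $\rho(i+1)$ a descent bottom. Let $f$ (resp. $g$) be the increasing word of the descent bottoms (resp. of the letters that are not descent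 bottoms). Let $f'$ be the arrangement of the descent tops in which each letter $x$ has exactly $(2\text{-}31)_x\rho$ larger letters to its left, and $g'$ the arrangement of the letters that are not descent tops in which each letter $x$ has exactly $(2\text{-}31)_x\rho$ smaller letters to its right. These arrangements exist and are unique. $\Phi(\rho)\in\mathfrak S_m$ is the permutation $\tau$ such that $\tau(x)$ is the letter above $x$ in the biword $\binom{f}{f'}\binom{g}{g'}$. For $\sigma\in\mathfrak S_m$ let $\hat\sigma=(\sigma(1)+1)\cdots(\sigma(m)+1)\,1\in\mathfrak S_{m+1}$ and $\tau=\Phi(\hat\sigma)$; then $\tau(1)=m+1$, and $\Psi(\sigma)=\tau(2)\cdots\tau(m+1)\in\mathfrak S_m$. **Theorem.** For every $n\ge 0$, $\psi_{FV}$ and $\psi_{YZL}$ are bijections from $\mathfrak S_{n+1}$ onto $\mathcal{LH}_n$, $\Psi$ is a bijection from $\mathfrak S_{n+1}$ onto itself, and $$\psi_{FV}=\psi_{YZL}\circ\Psi .$$ -/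

import Mathlib

open Finset

namespace LagHist

/-! Permutations of `[m] = {1, …, m}` are elements of `Equiv.Perm (Fin m)`; the element `i : Fin m`
stands for the integer `i + 1`, both for positions and for letters. -/

/-! ### The word of a permutation -/

/-- The word `σ(1) σ(2) ⋯ σ(m)`, as a function of the integer position `k = 1, …, m`, with integer
letters `1, …, m` and with the convention `σ(0) = σ(m+1) = 0`. -/
def word {m : ℕ} (σ : Equiv.Perm (Fin m)) (k : ℕ) : ℕ :=
  if h : 1 ≤ k ∧ k ≤ m then (σ ⟨k - 1, by omega⟩ : ℕ) + 1 else 0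

/-- The position (an integer in `1, …, m`) of the letter `x` in the word of `σ`. -/
def pos {m : ℕ} (σ : Equiv.Perm (Fin m)) (x : Fin m) : ℕ := (σ.symm x : ℕ) + 1

/-- The letter `x` is a peak of `σ`, with the convention `0–0`. -/
def IsPeak {m : ℕ} (σ : Equiv.Perm (Fin m)) (x : Fin m) : Prop :=
  word σ (pos σ x - 1) < word σ (pos σ x) ∧ word σ (pos σ x) > word σ (pos σ x + 1)

/-- The letter `x` is a valley of `σ`, with the convention `0–0`. -/
def IsValley {m : ℕ} (σ : Equiv.Perm (Fin m)) (x : Fin m) : Prop :=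
  word σ (pos σ x - 1) > word σ (pos σ x) ∧ word σ (pos σ x) < word σ (pos σ x + 1)

/-- The letter `x` is a double ascent of `σ`, with the convention `0–0`. -/
def IsDoubleAscent {m : ℕ} (σ : Equiv.Perm (Fin m)) (x : Fin m) : Prop :=
  word σ (pos σ x - 1) < word σ (pos σ x) ∧ word σ (pos σ x) < word σ (pos σ x + 1)

instance {m : ℕ} (σ : Equiv.Perm (Fin m)) (x : Fin m) : Decidable (IsPeak σ x) :=
  inferInstanceAs (Decidable (_ ∧ _))
instance {m : ℕ} (σ : Equiv.Perm (Fin m)) (x : Fin m) : Decidable (IsValley σ x) :=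
  inferInstanceAs (Decidable (_ ∧ _))
instance {m : ℕ} (σ : Equiv.Perm (Fin m)) (x : Fin m) : Decidable (IsDoubleAscent σ x) :=
  inferInstanceAs (Decidable (_ ∧ _))

/-- `(2-13)_x σ`: the number of adjacent pairs `σ(j) σ(j+1)` to the right of the letter `x` with
`σ(j) < x < σ(j+1)`. -/
def two13 {m : ℕ} (σ : Equiv.Perm (Fin m)) (x : Fin m) : ℕ :=
  #{j : Fin m | ∃ k : Fin m, (j : ℕ) + 1 = k ∧ σ.symm x < j ∧ σ j < x ∧ x < σ k}

/-- `(2-31)_x σ`: the number of adjacent pairs `σ(j) σ(j+1)` to the right of the letter `x` with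
`σ(j+1) < x < σ(j)`. -/
def two31 {m : ℕ} (σ : Equiv.Perm (Fin m)) (x : Fin m) : ℕ :=
  #{j : Fin m | ∃ k : Fin m, (j : ℕ) + 1 = k ∧ σ.symm x < j ∧ σ k < x ∧ x < σ j}

/-- `nest_i σ`, where `i` is a position. -/
def nest {m : ℕ} (σ : Equiv.Perm (Fin m)) (i : Fin m) : ℕ :=
  #{j : Fin m | (j < i ∧ i < σ i ∧ σ i < σ j) ∨ (σ j < σ i ∧ σ i ≤ i ∧ i < j)}

/-! ### Laguerre histories -/

/-- The steps of a 2-Motzkin path: up, down, blue level and red level. -/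
inductive Step
  | U
  | D
  | Lb
  | Lr
  deriving DecidableEq

/-- The height `h_k(s) = |s_1 ⋯ s_k|_U - |s_1 ⋯ s_k|_D` after `k` steps. -/
def height {n : ℕ} (s : Fin n → Step) (k : ℕ) : ℤ :=
  (#{j : Fin n | (j : ℕ) < k ∧ s j = Step.U} : ℤ) - #{j : Fin n | (j : ℕ) < k ∧ s j = Step.D}

/-- `s` is a 2-Motzkin path of length `n`. -/
def IsTwoMotzkin {n : ℕ} (s : Fin n → Step) : Prop :=
  (∀ k ≤ n, 0 ≤ height s k) ∧ height s n = 0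

/-- The set `LH_n` of Laguerre histories `(s, p)` of length `n`: `s` is a 2-Motzkin path and
`0 ≤ p_i ≤ h_{i-1}(s)`. For `i : Fin n`, which stands for the integer `i + 1`, the height before
the step is `height s i`. -/
def laguerreHistories (n : ℕ) : Set ((Fin n → Step) × (Fin n → ℕ)) :=
  {sp | IsTwoMotzkin sp.1 ∧ ∀ i : Fin n, (sp.2 i : ℤ) ≤ height sp.1 i}

/-! ### The maps `ψ_FV` and `ψ_YZL` -/

/-- The Françon–Viennot map. The letter `i ∈ [n]` of a permutation of `[n+1]` is `i.castSucc`.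
Exactly one of the four cases valley, peak, double ascent, double descent applies to a letter, so
the last case is that `i` is a double descent: `σ(k-1) > i > σ(k+1)`, where `i = σ(k)`. -/
def psiFV {n : ℕ} (σ : Equiv.Perm (Fin (n + 1))) : (Fin n → Step) × (Fin n → ℕ) :=
  (fun i =>
    if IsValley σ i.castSucc then Step.U
    else if IsPeak σ i.castSucc then Step.D
    else if IsDoubleAscent σ i.castSucc then Step.Lb
    else Step.Lr,
   fun i => two13 σ i.castSucc)

/-- `Scval σ = {i ∈ [n] : i < σ(i), i + 1 ≤ σ⁻¹(i + 1)}`. -/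
def scval {n : ℕ} (σ : Equiv.Perm (Fin (n + 1))) : Finset (Fin n) :=
  {i | i.castSucc < σ i.castSucc ∧ i.succ ≤ σ.symm i.succ}

/-- `Scpeak σ = {i ∈ [n] : i ≥ σ(i), i + 1 > σ⁻¹(i + 1)}`. -/
def scpeak {n : ℕ} (σ : Equiv.Perm (Fin (n + 1))) : Finset (Fin n) :=
  {i | i.castSucc ≥ σ i.castSucc ∧ i.succ > σ.symm i.succ}

/-- `Sde σ = {i ∈ [n] : i < σ(i), i + 1 > σ⁻¹(i + 1)}`; the remaining set is
`Sdn σ = {i ∈ [n] : i ≥ σ(i), i + 1 ≤ σ⁻¹(i + 1)}`. -/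
def sde {n : ℕ} (σ : Equiv.Perm (Fin (n + 1))) : Finset (Fin n) :=
  {i | i.castSucc < σ i.castSucc ∧ i.succ > σ.symm i.succ}

/-- The Yan–Zhou–Lin map. The four shifted cyclic sets `Scval`, `Scpeak`, `Sde`, `Sdn` partition
`[n]`, so the last case is `i ∈ Sdn σ`. -/
def psiYZL {n : ℕ} (σ : Equiv.Perm (Fin (n + 1))) : (Fin n → Step) × (Fin n → ℕ) :=
  (fun i =>
    if i ∈ scval σ then Step.U
    else if i ∈ scpeak σ then Step.D
    else if i ∈ sde σ then Step.Lb
    else Step.Lr,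
   fun i => nest σ i.castSucc)

/-! ### The bijection `Φ` -/

/-- The set of descent tops: letters `σ(i)` with `σ(i) > σ(i+1)`. -/
def descTops {m : ℕ} (σ : Equiv.Perm (Fin m)) : Finset (Fin m) :=
  {x | ∃ i j : Fin m, (i : ℕ) + 1 = j ∧ σ j < σ i ∧ x = σ i}

/-- The set of descent bottoms: letters `σ(i+1)` with `σ(i) > σ(i+1)`. -/
def descBots {m : ℕ} (σ : Equiv.Perm (Fin m)) : Finset (Fin m) :=
  {x | ∃ i j : Fin m, (i : ℕ) + 1 = j ∧ σ j < σ i ∧ x = σ j}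

/-- `τ = Φ(σ)`. The columns of the concatenated biword `(f g / f' g')` are the pairs `(τ(x) / x)`:
the columns of `(f / f')` are those with `x` a descent top, and there the top row `f` is the
increasing word of the descent bottoms; the columns of `(g / g')` are those with `x` not a descent
top, and there `g` is the increasing word of the letters that are not descent bottoms. As `f` and
`g` increase, `y` stands to the left of `x` in `f'` (or in `g'`) exactly when `τ(y) < τ(x)`. The
last two clauses say that the inversion bottom number of each `x` in `f'` (the number of larger
letters to its left) and the inversion top number of each `x` in `g'` (the number of smaller
letters to its right) are `(2-31)_x σ`. -/
structure IsPhi {m : ℕ} (σ τ : Equiv.Perm (Fin m)) : Prop where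
  top_mem : ∀ x ∈ descTops σ, τ x ∈ descBots σ
  top_notMem : ∀ x ∉ descTops σ, τ x ∉ descBots σ
  invBot : ∀ x ∈ descTops σ, #{y ∈ descTops σ | x < y ∧ τ y < τ x} = two31 σ x
  invTop : ∀ x ∉ descTops σ, #{y ∈ (descTops σ)ᶜ | y < x ∧ τ x < τ y} = two31 σ x

/-- The rank in `B` determines an element of `B`. -/
theorem rank_inj {β : Type*} [LinearOrder β] {B : Finset β} {b c : β} (hb : b ∈ B) (hc : c ∈ B)
    (h : #{z ∈ B | z < b} = #{z ∈ B | z < c}) : b = c := by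
  have key : ∀ {b c : β}, b ∈ B → b < c → #{z ∈ B | z < b} < #{z ∈ B | z < c} := by
    intro b c hb hbc
    apply Finset.card_lt_card
    rw [Finset.ssubset_iff_of_subset]
    · exact ⟨b, by simp [hb, hbc], by simp⟩
    · intro z hz
      simp only [mem_filter] at hz ⊢
      exact ⟨hz.1, hz.2.trans hbc⟩
  rcases lt_trichotomy b c with h1 | h1 | h1
  · exact absurd h (key hb h1).ne
  · exact h1
  · exact absurd h (key hc h1).ne'

theorem exists_rank {β : Type*} [LinearOrder β] (B : Finset β) (k : ℕ) (hk : k < #B) :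
    ∃ b ∈ B, #{z ∈ B | z < b} = k := by
  have hm : ∀ b ∈ B, #{z ∈ B | z < b} ∈ range #B := by
    intro b hb
    rw [mem_range]
    apply Finset.card_lt_card
    rw [Finset.ssubset_iff_of_subset (filter_subset _ _)]
    exact ⟨b, hb, by simp⟩
  obtain ⟨b, hb, h⟩ := Finset.surj_on_of_inj_on_of_card_le (s := B) (t := range #B)
    (fun b _ => #{z ∈ B | z < b}) hm (fun b c hb hc h => rank_inj hb hc h) (by simp) k
    (mem_range.2 hk)
  exact ⟨b, hb, h.symm⟩

/-- An injection `t` of `A` into `B`, where `#A = #B`, is onto `B`. -/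
theorem image_eq_of_inj {α β : Type*} [DecidableEq β] {A : Finset α} {B : Finset β} {t : α → β}
    (hc : #A = #B) (hm : ∀ x ∈ A, t x ∈ B) (hi : Set.InjOn t A) : A.image t = B := by
  apply Finset.eq_of_subset_of_card_le
  · intro y hy
    obtain ⟨x, hx, rfl⟩ := mem_image.1 hy
    exact hm x hx
  · rw [Finset.card_image_of_injOn hi, hc]

theorem card_filter_comp {α β : Type*} [LinearOrder β] {A : Finset α} {B : Finset β} {t : α → β}
    (hc : #A = #B) (hm : ∀ x ∈ A, t x ∈ B) (hi : Set.InjOn t A) (b : β) :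
    #{y ∈ A | t y < b} = #{z ∈ B | z < b} := by
  rw [← image_eq_of_inj hc hm hi, Finset.filter_image, Finset.card_image_of_injOn]
  exact hi.mono (coe_subset.2 (filter_subset _ _))

/-- Words are determined by their inversion bottom numbers: existence. -/
theorem exists_invBot {α β : Type*} [LinearOrder α] [LinearOrder β] [Nonempty β]
    (c : α → ℕ) (A : Finset α) : ∀ B : Finset β, #A = #B → (∀ x ∈ A, c x ≤ #{y ∈ A | x < y}) →
    ∃ t : α → β, (∀ x ∈ A, t x ∈ B) ∧ Set.InjOn t A ∧
      ∀ x ∈ A, #{y ∈ A | x < y ∧ t y < t x} = c x := by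
  induction A using Finset.induction_on_min with
  | empty => intro B _ _; exact ⟨fun _ => Classical.arbitrary β, by simp, by simp, by simp⟩
  | insert a s ha ih =>
    intro B hB hc
    have has : a ∉ s := fun h => lt_irrefl _ (ha a h)
    have hf : ∀ x ∈ s, ∀ P : α → Prop, ∀ [DecidablePred P],
        filter (fun y => x < y ∧ P y) (insert a s) = filter (fun y => x < y ∧ P y) s := by
      intro x hx P _
      rw [Finset.filter_insert, if_neg]
      exact fun h => lt_asymm h.1 (ha x hx)
    rw [card_insert_of_notMem has] at hB
    obtain ⟨b, hb, hbr⟩ := exists_rank B (c a) (by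
      have := hc a (mem_insert_self a s)
      rw [Finset.filter_insert, if_neg (lt_irrefl a)] at this
      have := this.trans (card_filter_le _ _)
      omega)
    have hcard : #s = #(B.erase b) := by rw [card_erase_of_mem hb]; omega
    obtain ⟨t, hm, hi, hr⟩ := ih (B.erase b) hcard (by
      intro x hx
      refine (hc x (mem_insert_of_mem hx)).trans (le_of_eq ?_)
      rw [Finset.filter_insert, if_neg (fun h => lt_asymm h (ha x hx))])
    have hta : ∀ x ∈ s, Function.update t a b x = t x := fun x hx =>
      Function.update_of_ne (fun h : x = a => has (h ▸ hx)) _ _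
    refine ⟨Function.update t a b, ?_, ?_, ?_⟩
    · intro x hx
      rcases mem_insert.1 hx with rfl | hx
      · simpa using hb
      · rw [hta x hx]; exact mem_of_mem_erase (hm x hx)
    · rw [coe_insert, Set.injOn_insert (by simpa using has)]
      refine ⟨?_, ?_⟩
      · intro x hx y hy h
        rw [hta x hx, hta y hy] at h
        exact hi hx hy h
      · rintro ⟨x, hx, h⟩
        rw [hta x hx, Function.update_self] at h
        exact (mem_erase.1 (hm x hx)).1 h
    · intro x hx
      rcases mem_insert.1 hx with rfl | hx
      · rw [Finset.filter_insert, if_neg (fun h => lt_irrefl _ h.1)]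
        have h1 : {y ∈ s | x < y ∧ Function.update t x b y < Function.update t x b x}
            = {y ∈ s | t y < b} := by
          apply Finset.filter_congr
          intro y hy
          rw [hta y hy, Function.update_self]
          exact ⟨fun h => h.2, fun h => ⟨ha y hy, h⟩⟩
        rw [h1, card_filter_comp hcard hm hi, ← hbr]
        congr 1
        ext z
        simp only [mem_filter, mem_erase]
        exact ⟨fun h => ⟨h.1.2, h.2⟩, fun h => ⟨⟨h.2.ne, h.1⟩, h.2⟩⟩
      · rw [hf x hx, ← hr x hx]
        congr 1
        apply Finset.filter_congr
        intro y hy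
        rw [hta y hy, hta x hx]

/-- Words are determined by their inversion top numbers: existence. -/
theorem exists_invTop {α β : Type*} [LinearOrder α] [LinearOrder β] [Nonempty β]
    (c : α → ℕ) (A : Finset α) (B : Finset β) (hc : #A = #B)
    (h : ∀ x ∈ A, c x ≤ #{y ∈ A | y < x}) :
    ∃ t : α → β, (∀ x ∈ A, t x ∈ B) ∧ Set.InjOn t A ∧
      ∀ x ∈ A, #{y ∈ A | y < x ∧ t x < t y} = c x :=
  exists_invBot (α := αᵒᵈ) (β := βᵒᵈ) c A B hc h

/-- Words are determined by their inversion bottom numbers: uniqueness. -/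
theorem unique_invBot {α β : Type*} [LinearOrder α] [LinearOrder β] (t t' : α → β)
    (A : Finset α) : ∀ B : Finset β, #A = #B → (∀ x ∈ A, t x ∈ B) → (∀ x ∈ A, t' x ∈ B) →
    Set.InjOn t A → Set.InjOn t' A →
    (∀ x ∈ A, #{y ∈ A | x < y ∧ t y < t x} = #{y ∈ A | x < y ∧ t' y < t' x}) →
    ∀ x ∈ A, t x = t' x := by
  induction A using Finset.induction_on_min with
  | empty => simp
  | insert a s ha ih =>
    intro B hB hm hm' hi hi' hr
    have has : a ∉ s := fun h => lt_irrefl _ (ha a h)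
    have hrank : ∀ u : α → β, (∀ x ∈ insert a s, u x ∈ B) → Set.InjOn u (insert a s : Finset α) →
        #{y ∈ insert a s | a < y ∧ u y < u a} = #{z ∈ B | z < u a} := by
      intro u hu hui
      rw [← card_filter_comp hB hu hui]
      congr 1
      apply Finset.filter_congr
      intro y hy
      refine ⟨fun h => h.2, fun h => ⟨?_, h⟩⟩
      rcases mem_insert.1 hy with rfl | hy
      · exact absurd h (lt_irrefl _)
      · exact ha y hy
    have hae : t a = t' a := by
      apply rank_inj (hm a (mem_insert_self a s)) (hm' a (mem_insert_self a s))
      rw [← hrank t hm hi, ← hrank t' hm' hi']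
      exact hr a (mem_insert_self a s)
    have hme : ∀ u : α → β, (∀ x ∈ insert a s, u x ∈ B) → Set.InjOn u (insert a s : Finset α) →
        ∀ x ∈ s, u x ∈ B.erase (u a) := by
      intro u hu hui x hx
      refine mem_erase.2 ⟨fun h => ?_, hu x (mem_insert_of_mem hx)⟩
      have := hui (by simp [hx]) (by simp) h
      exact has (this ▸ hx)
    intro x hx
    rcases mem_insert.1 hx with rfl | hx
    · exact hae
    · refine ih (B.erase (t a)) ?_ (hme t hm hi) (hae ▸ hme t' hm' hi')
        (hi.mono (by simp)) (hi'.mono (by simp)) ?_ x hx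
      · rw [card_erase_of_mem (hm a (mem_insert_self a s)), ← hB, card_insert_of_notMem has]
        omega
      · intro z hz
        have := hr z (mem_insert_of_mem hz)
        rwa [Finset.filter_insert, if_neg (fun h => lt_asymm h.1 (ha z hz)),
          Finset.filter_insert, if_neg (fun h => lt_asymm h.1 (ha z hz))] at this

theorem card_descTops {m : ℕ} (σ : Equiv.Perm (Fin m)) : #(descTops σ) = #(descBots σ) := by
  have h1 : descTops σ = (({p : Fin m × Fin m | (p.1 : ℕ) + 1 = p.2 ∧ σ p.2 < σ p.1} :
      Finset (Fin m × Fin m))).image (fun p => σ p.1) := by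
    ext x
    simp only [descTops, mem_filter, mem_univ, true_and, mem_image, Prod.exists]
    constructor
    · rintro ⟨i, j, h, h', rfl⟩; exact ⟨i, j, ⟨h, h'⟩, rfl⟩
    · rintro ⟨i, j, ⟨h, h'⟩, rfl⟩; exact ⟨i, j, h, h', rfl⟩
  have h2 : descBots σ = (({p : Fin m × Fin m | (p.1 : ℕ) + 1 = p.2 ∧ σ p.2 < σ p.1} :
      Finset (Fin m × Fin m))).image (fun p => σ p.2) := by
    ext x
    simp only [descBots, mem_filter, mem_univ, true_and, mem_image, Prod.exists]
    constructor
    · rintro ⟨i, j, h, h', rfl⟩; exact ⟨i, j, ⟨h, h'⟩, rfl⟩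
    · rintro ⟨i, j, ⟨h, h'⟩, rfl⟩; exact ⟨i, j, h, h', rfl⟩
  rw [h1, h2, card_image_of_injOn, card_image_of_injOn]
  · rintro ⟨a, b⟩ hp ⟨c, d⟩ hq h
    simp only [coe_filter, mem_univ, true_and, Set.mem_ofPred_eq, EmbeddingLike.apply_eq_iff_eq]
      at hp hq h
    ext <;> simp only [] <;> omega
  · rintro ⟨a, b⟩ hp ⟨c, d⟩ hq h
    simp only [coe_filter, mem_univ, true_and, Set.mem_ofPred_eq, EmbeddingLike.apply_eq_iff_eq]
      at hp hq h
    ext <;> simp only [] <;> omega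

theorem two31_le_top {m : ℕ} (σ : Equiv.Perm (Fin m)) (x : Fin m) :
    two31 σ x ≤ #{y ∈ descTops σ | x < y} := by
  unfold two31
  refine Finset.card_le_card_of_injOn σ ?_ σ.injective.injOn
  intro j hj
  simp only [coe_filter, mem_univ, true_and, Set.mem_ofPred_eq] at hj
  obtain ⟨k, hk, _, h1, h2⟩ := hj
  simp only [coe_filter, Set.mem_ofPred_eq, descTops, mem_filter, mem_univ, true_and]
  exact ⟨⟨j, k, hk, h1.trans h2, rfl⟩, h2⟩

/-- From each position one descends to a letter that is not a descent top. -/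
theorem exists_run {m : ℕ} (σ : Equiv.Perm (Fin m)) (d : ℕ) : ∀ p : Fin m, m - (p : ℕ) = d →
    ∃ q : Fin m, p ≤ q ∧ σ q ∉ descTops σ ∧ ∀ r, p ≤ r → r ≤ q → σ r ≤ σ p := by
  induction d with
  | zero => intro p hp; have := p.2; omega
  | succ d ih =>
    intro p hp
    by_cases h : σ p ∈ descTops σ
    · simp only [descTops, mem_filter, mem_univ, true_and, EmbeddingLike.apply_eq_iff_eq] at h
      obtain ⟨i, j, hij, hlt, rfl⟩ := h
      obtain ⟨q, hq, hq', hr⟩ := ih j (by omega)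
      refine ⟨q, by rw [Fin.le_def] at *; omega, hq', fun r h1 h2 => ?_⟩
      rcases eq_or_ne p r with rfl | hne
      · exact le_rfl
      · refine (hr r ?_ h2).trans hlt.le
        rw [Fin.le_def] at *
        have : (p : ℕ) ≠ r := fun h => hne (Fin.ext h)
        omega
    · exact ⟨p, le_rfl, h, fun r h1 h2 => by rw [le_antisymm h1 h2]⟩

theorem two31_le_bot {m : ℕ} (σ : Equiv.Perm (Fin m)) (x : Fin m) :
    two31 σ x ≤ #{y ∈ (descTops σ)ᶜ | y < x} := by
  unfold two31
  choose q hq hq' hr using fun p : Fin m => exists_run σ _ p rfl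
  let nx : Fin m → Fin m := fun j => if h : (j : ℕ) + 1 < m then ⟨j + 1, h⟩ else j
  have hnx : ∀ j k : Fin m, (j : ℕ) + 1 = k → nx j = k := by
    intro j k h
    have : (j : ℕ) + 1 < m := by omega
    ext
    simp only [nx, this, dite_true]
    exact h
  have main : ∀ j j' k k' : Fin m, (j : ℕ) + 1 = k → (j' : ℕ) + 1 = k' → σ k < x → x < σ j' →
      q k = q k' → ¬ j < j' := by
    intro j j' k k' h h' hk hj' hqq hlt
    have h1 : k ≤ j' := by rw [Fin.le_def]; rw [Fin.lt_def] at hlt; omega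
    have h2 : j' ≤ q k := by
      rw [hqq]; refine le_trans ?_ (hq k'); rw [Fin.le_def]; omega
    exact absurd ((hr k j' h1 h2).trans_lt hk) (lt_asymm hj')
  refine Finset.card_le_card_of_injOn (fun j => σ (q (nx j))) ?_ ?_
  · intro j hj
    simp only [coe_filter, mem_univ, true_and, Set.mem_ofPred_eq] at hj
    obtain ⟨k, hk, _, h1, h2⟩ := hj
    simp only [coe_filter, Set.mem_ofPred_eq, mem_compl, hnx j k hk]
    exact ⟨hq' k, (hr k _ (hq k) le_rfl).trans_lt h1⟩
  · intro j hj j' hj' he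
    simp only [coe_filter, mem_univ, true_and, Set.mem_ofPred_eq] at hj hj'
    obtain ⟨k, hk, _, h1, h2⟩ := hj
    obtain ⟨k', hk', _, h1', h2'⟩ := hj'
    simp only [hnx j k hk, hnx j' k' hk', EmbeddingLike.apply_eq_iff_eq] at he
    have a := main j j' k k' hk hk' h1 h2' he
    have b := main j' j k' k hk' hk h1' h2 he.symm
    exact le_antisymm (not_lt.1 b) (not_lt.1 a)

/-- The construction of `Φ(σ)` is possible in exactly one way. -/
theorem existsUnique_isPhi {m : ℕ} (σ : Equiv.Perm (Fin m)) : ∃! τ, IsPhi σ τ := by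
  rcases isEmpty_or_nonempty (Fin m) with hE | hN
  · exact ⟨1, ⟨fun x => isEmptyElim x, fun x => isEmptyElim x, fun x => isEmptyElim x,
      fun x => isEmptyElim x⟩, fun _ _ => Subsingleton.elim _ _⟩
  have hcc : #(descTops σ)ᶜ = #(descBots σ)ᶜ := by
    rw [card_compl, card_compl, card_descTops]
  apply existsUnique_of_exists_of_unique
  · obtain ⟨t, hm, hi, hr⟩ := exists_invBot (two31 σ) (descTops σ) (descBots σ) (card_descTops σ)
      (fun x _ => two31_le_top σ x)
    obtain ⟨u, hm', hi', hr'⟩ := exists_invTop (two31 σ)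
      (descTops σ)ᶜ (descBots σ)ᶜ hcc (fun x _ => two31_le_bot σ x)
    let v : Fin m → Fin m := fun x => if x ∈ descTops σ then t x else u x
    have hvt : ∀ x ∈ descTops σ, v x = t x := fun x hx => if_pos hx
    have hvu : ∀ x ∉ descTops σ, v x = u x := fun x hx => if_neg hx
    have hb : ∀ x ∉ descTops σ, v x ∉ descBots σ := fun x hx => by
      rw [hvu x hx]; exact mem_compl.1 (hm' x (mem_compl.2 hx))
    have ht : ∀ x ∈ descTops σ, v x ∈ descBots σ := fun x hx => by
      rw [hvt x hx]; exact hm x hx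
    have hv : Function.Injective v := by
      intro x y h
      by_cases hx : x ∈ descTops σ <;> by_cases hy : y ∈ descTops σ
      · rw [hvt x hx, hvt y hy] at h; exact hi hx hy h
      · exact absurd (h ▸ ht x hx) (hb y hy)
      · exact absurd (h ▸ ht y hy) (hb x hx)
      · rw [hvu x hx, hvu y hy] at h
        exact hi' (mem_coe.2 (mem_compl.2 hx)) (mem_coe.2 (mem_compl.2 hy)) h
    refine ⟨Equiv.ofBijective v (Finite.injective_iff_bijective.1 hv), ht, hb, ?_, ?_⟩
    · intro x hx
      rw [← hr x hx]
      congr 1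
      apply Finset.filter_congr
      intro y hy
      simp only [Equiv.ofBijective_apply, hvt x hx, hvt y hy]
    · intro x hx
      rw [← hr' x (mem_compl.2 hx)]
      congr 1
      apply Finset.filter_congr
      intro y hy
      simp only [Equiv.ofBijective_apply, hvu x hx, hvu y (mem_compl.1 hy)]
  · intro τ τ' h h'
    ext1 x
    by_cases hx : x ∈ descTops σ
    · refine unique_invBot τ τ' (descTops σ) (descBots σ) (card_descTops σ) h.top_mem h'.top_mem
        τ.injective.injOn τ'.injective.injOn ?_ x hx
      intro z hz
      rw [h.invBot z hz, h'.invBot z hz]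
    · refine unique_invBot (α := (Fin m)ᵒᵈ) (β := (Fin m)ᵒᵈ) τ τ' (descTops σ)ᶜ (descBots σ)ᶜ hcc
        (fun z hz => mem_compl.2 (h.top_notMem z (mem_compl.1 hz)))
        (fun z hz => mem_compl.2 (h'.top_notMem z (mem_compl.1 hz)))
        τ.injective.injOn τ'.injective.injOn ?_ x (mem_compl.2 hx)
      intro z hz
      exact (h.invTop z (mem_compl.1 hz)).trans (h'.invTop z (mem_compl.1 hz)).symm

/-- The map `Φ : S_m → S_m`. -/
noncomputable def Phi {m : ℕ} (σ : Equiv.Perm (Fin m)) : Equiv.Perm (Fin m) :=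
  (existsUnique_isPhi σ).choose

theorem isPhi_Phi {m : ℕ} (σ : Equiv.Perm (Fin m)) : IsPhi σ (Phi σ) :=
  (existsUnique_isPhi σ).choose_spec.1

/-! ### The bijection `Ψ` -/

/-- `σ̂ = (σ(1)+1) (σ(2)+1) ⋯ (σ(m)+1) 1`, a permutation of `[m+1]`. -/
def hat {m : ℕ} (σ : Equiv.Perm (Fin m)) : Equiv.Perm (Fin (m + 1)) where
  toFun := Fin.lastCases 0 (fun i => (σ i).succ)
  invFun := Fin.cases (Fin.last m) (fun i => (σ.symm i).castSucc)
  left_inv := by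
    intro i
    induction i using Fin.lastCases <;> simp
  right_inv := by
    intro i
    induction i using Fin.cases <;> simp

/-- If a word ends below `x` and is above `x` at position `p`, then it descends through `x`. -/
theorem exists_crossing {m : ℕ} (σ : Equiv.Perm (Fin (m + 1))) (x : Fin (m + 1))
    (hl : σ (Fin.last m) < x) (d : ℕ) : ∀ p : Fin (m + 1), m - (p : ℕ) = d → σ.symm x < p →
    x < σ p → ∃ j k : Fin (m + 1), (j : ℕ) + 1 = k ∧ σ.symm x < j ∧ σ k < x ∧ x < σ j := by
  induction d with
  | zero =>
    intro p hp _ h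
    have : p = Fin.last m := by ext; have := p.2; simp only [Fin.val_last]; omega
    rw [this] at h
    exact absurd h (lt_asymm hl)
  | succ d ih =>
    intro p hp hxp h
    have hp1 : (p : ℕ) + 1 < m + 1 := by omega
    rcases lt_trichotomy (σ ⟨p + 1, hp1⟩) x with h1 | h1 | h1
    · exact ⟨p, ⟨p + 1, hp1⟩, rfl, hxp, h1, h⟩
    · exfalso
      have h2 : σ.symm x = ⟨p + 1, hp1⟩ := by rw [← h1, Equiv.symm_apply_apply]
      rw [h2, Fin.lt_def] at hxp
      simp only at hxp
      omega
    · refine ih ⟨p + 1, hp1⟩ (by simp only; omega) ?_ h1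
      rw [Fin.lt_def] at hxp ⊢
      simp only
      omega

/-- The first letter of `Φ(σ̂)` is `m + 1`. -/
theorem Phi_hat_zero {m : ℕ} (σ : Equiv.Perm (Fin m)) : Phi (hat σ) 0 = Fin.last m := by
  have hP := isPhi_Phi (hat σ)
  set τ := Phi (hat σ)
  set ρ := hat σ with hρ
  have hlast : ρ (Fin.last m) = 0 := by simp [hρ, hat]
  by_contra hne
  obtain ⟨x, hx⟩ : ∃ x, τ x = Fin.last m := τ.surjective _
  have hx0 : x ≠ 0 := fun h => hne (h ▸ hx)
  have hxt : x ∉ descTops ρ := by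
    intro h
    have := hP.top_mem x h
    rw [hx] at this
    simp only [descBots, mem_filter, mem_univ, true_and] at this
    obtain ⟨i, j, _, h1, h2⟩ := this
    rw [← h2] at h1
    exact absurd (Fin.le_last (ρ i)) (not_le.2 h1)
  have hc := hP.invTop x hxt
  rw [hx, Finset.filter_false_of_mem (fun y _ h => absurd (Fin.le_last (τ y)) (not_le.2 h.2)),
    card_empty] at hc
  have hxl : ρ.symm x ≠ Fin.last m := by
    intro h
    apply hx0
    rw [← hlast, ← h, Equiv.apply_symm_apply]
  have hlt : (ρ.symm x : ℕ) + 1 < m + 1 := by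
    have := Fin.val_lt_last hxl
    omega
  have hup : x < ρ ⟨ρ.symm x + 1, hlt⟩ := by
    rcases lt_trichotomy (ρ ⟨ρ.symm x + 1, hlt⟩) x with h1 | h1 | h1
    · exfalso
      apply hxt
      simp only [descTops, mem_filter, mem_univ, true_and]
      exact ⟨ρ.symm x, ⟨ρ.symm x + 1, hlt⟩, rfl, by simpa using h1, by simp⟩
    · exfalso
      have h2 : ρ.symm x = ⟨ρ.symm x + 1, hlt⟩ := by
        apply ρ.injective
        rw [Equiv.apply_symm_apply, h1]
      have := congrArg Fin.val h2
      simp only at this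
      omega
    · exact h1
  obtain ⟨j, k, h1, h2, h3, h4⟩ := exists_crossing ρ x (by rw [hlast]; exact Fin.pos_of_ne_zero hx0)
    _ ⟨ρ.symm x + 1, hlt⟩ rfl (by rw [Fin.lt_def]; simp) hup
  have hmem : j ∈ ({j | ∃ k : Fin (m + 1), (j : ℕ) + 1 = k ∧ ρ.symm x < j ∧ ρ k < x ∧ x < ρ j} :
      Finset (Fin (m + 1))) := by
    simp only [mem_filter, mem_univ, true_and]
    exact ⟨k, h1, h2, h3, h4⟩
  unfold two31 at hc
  rw [card_eq_zero.1 hc.symm] at hmem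
  simp at hmem

theorem Phi_hat_succ_ne {m : ℕ} (σ : Equiv.Perm (Fin m)) (i : Fin m) :
    Phi (hat σ) i.succ ≠ Fin.last m := by
  rw [← Phi_hat_zero σ]
  exact fun h => Fin.succ_ne_zero i ((Phi (hat σ)).injective h)

theorem Phi_hat_symm_castSucc_ne {m : ℕ} (σ : Equiv.Perm (Fin m)) (i : Fin m) :
    (Phi (hat σ)).symm i.castSucc ≠ 0 := by
  intro h
  rw [Equiv.symm_apply_eq, Phi_hat_zero] at h
  exact (Fin.castSucc_lt_last i).ne h

/-- The Shin–Zeng map `Ψ : S_m → S_m`, `Ψ(σ) = τ(2) τ(3) ⋯ τ(m+1)` with `τ = Φ(σ̂)`. -/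
noncomputable def Psi {m : ℕ} (σ : Equiv.Perm (Fin m)) : Equiv.Perm (Fin m) where
  toFun i := (Phi (hat σ) i.succ).castPred (Phi_hat_succ_ne σ i)
  invFun i := ((Phi (hat σ)).symm i.castSucc).pred (Phi_hat_symm_castSucc_ne σ i)
  left_inv i := by simp
  right_inv i := by simp

end LagHist

/-! The map `psiFV` is proved bijective directly, the identity `psiFV_eq_psiYZL_Psi` is proved
letter by letter, and the statements about `psiYZL` and `Psi` are then formal.

For `psiFV`, delete the letters `1, 2, …` one after another and follow the maximal blocks of
remaining letters. Deleting a letter opens, splits or shrinks blocks according to whether its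
neighbours are larger, which is what its step records (`blocks_succ`). Hence the height is one less
than the number of blocks (`height_psiFV`), and the label of a letter is the number of blocks
starting to its right (`two13_eq_blocks`). That number decides which smaller letters precede it
(`pos_lt_pos_iff`), so the relative order of all letters can be recovered from the history: `psiFV`
is injective. Surjectivity is by counting: there are at most `(n+1)!` Laguerre histories, by a
recursion over the starting height (`exists_finset_laguerreSuffixes`).

For the comparison, let `τ = Φ(σ̂)`. Counting the descents that straddle `x` shows that the descent
tops of `σ̂` are exactly the `x` with `τ(x) < x`, and its descent bottoms the `x` with `x < τ⁻¹(x)`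
(`IsPhi.apply_lt_iff`, `IsPhi.lt_symm_iff`). Being a descent top or bottom says whether the right or
left neighbour is smaller or larger, so the steps agree. The same criterion makes the inversion
numbers in the definition of `Φ` count nestings, and since a word passes upwards and downwards
through a letter equally often, `(2-31)` in `σ̂` is `(2-13)` in `σ` up to a correction of one, which
the deletion of `τ(1)` absorbs (`nest_Psi`). -/

namespace LagHist

/-! ### Descent tops are the anti-excedances of `Φ(σ)` -/

/-- The pairs of adjacent positions at which `σ` descends. -/
def descPairs {m : ℕ} (σ : Equiv.Perm (Fin m)) : Finset (Fin m × Fin m) :=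
  {p | (p.1 : ℕ) + 1 = p.2 ∧ σ p.2 < σ p.1}

theorem card_descTops_filter {m : ℕ} (σ : Equiv.Perm (Fin m)) (P : Fin m → Prop)
    [DecidablePred P] : #{y ∈ descTops σ | P y} = #{p ∈ descPairs σ | P (σ p.1)} := by
  symm
  apply Finset.card_bij (fun p _ => σ p.1)
  · intro p hp
    simp only [descPairs, descTops, mem_filter, mem_univ, true_and] at hp ⊢
    exact ⟨⟨p.1, p.2, hp.1.1, hp.1.2, rfl⟩, hp.2⟩
  · rintro ⟨a, b⟩ hp ⟨c, d⟩ hq h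
    simp only [descPairs, mem_filter, mem_univ, true_and, EmbeddingLike.apply_eq_iff_eq] at hp hq h
    ext <;> simp only [] <;> omega
  · intro y hy
    simp only [descPairs, descTops, mem_filter, mem_univ, true_and] at hy ⊢
    obtain ⟨⟨i, j, h, h', rfl⟩, hP⟩ := hy
    exact ⟨(i, j), ⟨⟨h, h'⟩, hP⟩, rfl⟩

theorem card_descBots_filter {m : ℕ} (σ : Equiv.Perm (Fin m)) (P : Fin m → Prop)
    [DecidablePred P] : #{y ∈ descBots σ | P y} = #{p ∈ descPairs σ | P (σ p.2)} := by
  symm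
  apply Finset.card_bij (fun p _ => σ p.2)
  · intro p hp
    simp only [descPairs, descBots, mem_filter, mem_univ, true_and] at hp ⊢
    exact ⟨⟨p.1, p.2, hp.1.1, hp.1.2, rfl⟩, hp.2⟩
  · rintro ⟨a, b⟩ hp ⟨c, d⟩ hq h
    simp only [descPairs, mem_filter, mem_univ, true_and, EmbeddingLike.apply_eq_iff_eq] at hp hq h
    ext <;> simp only [] <;> omega
  · intro y hy
    simp only [descPairs, descBots, mem_filter, mem_univ, true_and] at hy ⊢
    obtain ⟨⟨i, j, h, h', rfl⟩, hP⟩ := hy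
    exact ⟨(i, j), ⟨⟨h, h'⟩, hP⟩, rfl⟩

/-- The descents whose top is at least `x` and whose bottom is below `x` outnumber
`(2-31)_x σ`, strictly if `x` is itself a descent top. -/
theorem two31_add_le_card_straddling {m : ℕ} (σ : Equiv.Perm (Fin m)) (x : Fin m) :
    two31 σ x + (if x ∈ descTops σ then 1 else 0) ≤
      #{p ∈ descPairs σ | σ p.2 < x ∧ ¬ σ p.1 < x} := by
  have h1 : two31 σ x = #{p ∈ descPairs σ | σ p.2 < x ∧ σ.symm x < p.1 ∧ x < σ p.1} := by
    symm
    apply Finset.card_bij (fun p _ => p.1)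
    · rintro ⟨j, k⟩ hp
      simp only [descPairs, mem_filter, mem_univ, true_and] at hp ⊢
      exact ⟨k, hp.1.1, hp.2.2.1, hp.2.1, hp.2.2.2⟩
    · rintro ⟨a, b⟩ hp ⟨c, d⟩ hq h
      simp only [descPairs, mem_filter, mem_univ, true_and] at hp hq h
      ext <;> simp only [] <;> omega
    · intro j hj
      simp only [mem_filter, mem_univ, true_and] at hj
      obtain ⟨k, hk, h1, h2, h3⟩ := hj
      exact ⟨(j, k), by simp [descPairs, hk, h1, h2, h3, h2.trans h3], rfl⟩
  have h2 : (if x ∈ descTops σ then 1 else 0) ≤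
      #{p ∈ descPairs σ | σ p.2 < x ∧ σ p.1 = x} := by
    split_ifs with hx
    · simp only [descTops, mem_filter, mem_univ, true_and] at hx
      obtain ⟨i, j, h, h', rfl⟩ := hx
      rw [Nat.one_le_iff_ne_zero, ← Nat.pos_iff_ne_zero, card_pos]
      exact ⟨(i, j), by simp [descPairs, h, h']⟩
    · exact Nat.zero_le _
  -- The descents strictly across `x` and the one with top `x` are disjoint subfamilies of the
  -- straddling descents.
  refine (add_le_add h1.le h2).trans ?_
  rw [← card_union_of_disjoint]
  · apply card_le_card
    intro p hp
    simp only [mem_union, mem_filter] at hp ⊢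
    rcases hp with ⟨h, h', _, h3⟩ | ⟨h, h', h3⟩
    · exact ⟨h, h', h3.not_gt⟩
    · exact ⟨h, h', h3.not_lt⟩
  · rw [disjoint_filter]
    exact fun p _ h h' => h.2.2.ne' h'.2

/-- A descent with bottom below `x` has its top either below `x` or not. The first kind is counted
by its tops, and the second kind is bounded below by the straddling estimate. -/
theorem card_descTops_lt_add_two31_le {m : ℕ} (σ : Equiv.Perm (Fin m)) (x : Fin m) :
    #{y ∈ descTops σ | y < x} + two31 σ x + (if x ∈ descTops σ then 1 else 0) ≤
      #{y ∈ descBots σ | y < x} := by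
  rw [card_descTops_filter, card_descBots_filter, add_assoc]
  refine (Nat.add_le_add_left (two31_add_le_card_straddling σ x) _).trans ?_
  rw [← card_union_of_disjoint]
  · apply card_le_card
    intro p hp
    simp only [descPairs, mem_union, mem_filter, mem_univ, true_and] at hp ⊢
    rcases hp with ⟨h, h'⟩ | ⟨h, h', _⟩
    · exact ⟨h, h.2.trans h'⟩
    · exact ⟨h, h'⟩
  · rw [disjoint_filter]
    exact fun p _ h h' => h'.2 h

theorem card_filter_lt_lt {m : ℕ} {B : Finset (Fin m)} {b x : Fin m} (hb : b ∈ B) (h : b < x) :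
    #{z ∈ B | z < b} < #{z ∈ B | z < x} := by
  apply card_lt_card
  rw [ssubset_iff_of_subset]
  · exact ⟨b, by simp [hb, h], by simp⟩
  · intro z hz
    simp only [mem_filter] at hz ⊢
    exact ⟨hz.1, hz.2.trans h⟩

/-- If `τ x` were at least `x`, too many descent bottoms would lie below `τ x`: that rank is the
number of descent tops `y` with `τ y < τ x`, hence at most the number of smaller descent tops plus
`(2-31)_x`. The straddling estimate exceeds this by one. -/
theorem IsPhi.apply_lt {m : ℕ} {σ τ : Equiv.Perm (Fin m)} (h : IsPhi σ τ) {x : Fin m}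
    (hx : x ∈ descTops σ) : τ x < x := by
  by_contra hlt
  have h1 := card_descTops_lt_add_two31_le σ x
  rw [if_pos hx] at h1
  have h2 := card_filter_comp (card_descTops σ) h.top_mem τ.injective.injOn (τ x)
  have h3 : #{z ∈ descBots σ | z < x} ≤ #{z ∈ descBots σ | z < τ x} := by
    apply card_le_card
    intro z hz
    simp only [mem_filter] at hz ⊢
    exact ⟨hz.1, hz.2.trans_le (not_lt.1 hlt)⟩
  have h4 : #{y ∈ descTops σ | τ y < τ x} ≤
      #{y ∈ descTops σ | y < x} + #{y ∈ descTops σ | x < y ∧ τ y < τ x} := by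
    rw [← card_union_of_disjoint]
    · apply card_le_card
      intro y hy
      simp only [mem_union, mem_filter] at hy ⊢
      rcases lt_trichotomy y x with hyx | rfl | hyx
      · exact Or.inl ⟨hy.1, hyx⟩
      · exact absurd hy.2 (lt_irrefl _)
      · exact Or.inr ⟨hy.1, hyx, hy.2⟩
    · rw [disjoint_filter]
      exact fun y _ h h' => lt_asymm h h'.1
  rw [h.invBot x hx] at h4
  omega

/-- The dual argument in the complements: the straddling estimate becomes an upper bound for the
number of non-bottoms below `x`. If `τ x < x`, then `τ x` itself is a non-bottom below `x`, which
makes the comparison of ranks strict and gives the contradiction. -/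
theorem IsPhi.le_apply {m : ℕ} {σ τ : Equiv.Perm (Fin m)} (h : IsPhi σ τ) {x : Fin m}
    (hx : x ∉ descTops σ) : x ≤ τ x := by
  by_contra hlt
  rw [not_le] at hlt
  have h1 := card_descTops_lt_add_two31_le σ x
  have hcc : #(descTops σ)ᶜ = #(descBots σ)ᶜ := by
    rw [card_compl, card_compl, card_descTops]
  have h2 := card_filter_comp hcc
    (fun z hz => mem_compl.2 (h.top_notMem z (mem_compl.1 hz))) τ.injective.injOn (τ x)
  have h3 := card_filter_lt_lt (mem_compl.2 (h.top_notMem x hx)) hlt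
  have h4 : #{y ∈ (descTops σ)ᶜ | y < x} ≤
      #{y ∈ (descTops σ)ᶜ | τ y < τ x} + #{y ∈ (descTops σ)ᶜ | y < x ∧ τ x < τ y} := by
    refine (card_le_card fun y hy => ?_).trans (card_union_le _ _)
    simp only [mem_union, mem_filter] at hy ⊢
    rcases lt_trichotomy (τ y) (τ x) with hyx | hyx | hyx
    · exact Or.inl ⟨hy.1, hyx⟩
    · exact absurd (τ.injective hyx) hy.2.ne
    · exact Or.inr ⟨hy.1, hy.2, hyx⟩
  rw [h.invTop x hx] at h4
  have h5 : ∀ A : Finset (Fin m), #{y ∈ A | y < x} + #{y ∈ Aᶜ | y < x} = #{y : Fin m | y < x} := by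
    intro A
    rw [← card_union_of_disjoint]
    · congr 1
      ext y
      simp only [mem_union, mem_filter, mem_compl, mem_univ, true_and]
      tauto
    · rw [disjoint_left]
      simp only [mem_filter, mem_compl]
      tauto
  have h6 := h5 (descTops σ)
  have h7 := h5 (descBots σ)
  omega

theorem IsPhi.apply_lt_iff {m : ℕ} {σ τ : Equiv.Perm (Fin m)} (h : IsPhi σ τ) (x : Fin m) :
    τ x < x ↔ x ∈ descTops σ :=
  ⟨fun h' => by_contra fun hx => (h.le_apply hx).not_gt h', h.apply_lt⟩

theorem IsPhi.lt_symm_iff {m : ℕ} {σ τ : Equiv.Perm (Fin m)} (h : IsPhi σ τ) (x : Fin m) :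
    x < τ.symm x ↔ x ∈ descBots σ := by
  have h1 := h.apply_lt_iff (τ.symm x)
  rw [Equiv.apply_symm_apply] at h1
  rw [h1]
  have h2 := h.top_mem (τ.symm x)
  have h3 := h.top_notMem (τ.symm x)
  rw [Equiv.apply_symm_apply] at h2 h3
  exact ⟨h2, fun h' => by_contra fun h'' => h3 h'' h'⟩

/-- At a descent top `x`, the restriction to descent tops in the inversion bottom number is
automatic. -/
theorem IsPhi.card_of_mem {m : ℕ} {σ τ : Equiv.Perm (Fin m)} (h : IsPhi σ τ) {x : Fin m}
    (hx : x ∈ descTops σ) : #{y : Fin m | x < y ∧ τ y < τ x} = two31 σ x := by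
  rw [← h.invBot x hx]
  congr 1
  ext y
  simp only [mem_filter, mem_univ, true_and]
  refine ⟨fun hy => ⟨?_, hy⟩, fun hy => hy.2⟩
  rw [← h.apply_lt_iff]
  exact hy.2.trans ((h.apply_lt hx).trans hy.1)

/-- At a letter `x` that is not a descent top, the restriction to such letters in the inversion
top number is automatic. -/
theorem IsPhi.card_of_notMem {m : ℕ} {σ τ : Equiv.Perm (Fin m)} (h : IsPhi σ τ) {x : Fin m}
    (hx : x ∉ descTops σ) : #{y : Fin m | y < x ∧ τ x < τ y} = two31 σ x := by
  rw [← h.invTop x hx]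
  congr 1
  ext y
  simp only [mem_filter, mem_univ, true_and, mem_compl]
  refine ⟨fun hy => ⟨?_, hy⟩, fun hy => hy.2⟩
  rw [← h.apply_lt_iff, not_lt]
  exact hy.1.le.trans ((h.le_apply hx).trans hy.2.le)

section

/-! ### The blocks of large letters of a word -/

variable {m : ℕ} (σ : Equiv.Perm (Fin m))

theorem word_zero : word σ 0 = 0 := dif_neg (by omega)

theorem word_succ_self : word σ (m + 1) = 0 := dif_neg (by omega)

theorem word_succ (i : Fin m) : word σ (i + 1) = σ i + 1 := by
  unfold word
  rw [dif_pos (by omega)]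
  simp

theorem word_pos (x : Fin m) : word σ (pos σ x) = x + 1 := by
  rw [pos, word_succ, Equiv.apply_symm_apply]

theorem word_le (k : ℕ) : word σ k ≤ m := by
  unfold word
  split_ifs with h
  · exact (σ _).2
  · exact Nat.zero_le _

theorem one_le_pos (x : Fin m) : 1 ≤ pos σ x := Nat.le_add_left _ _

theorem pos_le (x : Fin m) : pos σ x ≤ m := (σ.symm x).2

theorem word_eq_iff (x : Fin m) (k : ℕ) : word σ k = x + 1 ↔ k = pos σ x := by
  refine ⟨fun h => ?_, fun h => h ▸ word_pos σ x⟩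
  unfold word at h
  split_ifs at h with hk
  have h1 : σ ⟨k - 1, by omega⟩ = x := Fin.ext (by omega)
  rw [pos, ← h1, Equiv.symm_apply_apply]
  simp only
  omega

/-- The number of maximal blocks of letters that are at least `y` and that start to the right of
position `P`. -/
def blocks (y P : ℕ) : ℕ :=
  ∑ j ∈ Ico P (m + 1), if word σ j < y ∧ y ≤ word σ (j + 1) then 1 else 0

theorem blocks_anti (y : ℕ) {P Q : ℕ} (h : P ≤ Q) : blocks σ y Q ≤ blocks σ y P :=
  sum_le_sum_of_subset (Ico_subset_Ico_left h)

/-- The blocks of letters greater than `x`, compared with those of letters at least `x`. -/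
theorem blocks_succ (x : Fin m) (P : ℕ) :
    blocks σ (x + 2) P + (if P < pos σ x ∧ word σ (pos σ x - 1) < x + 1 then 1 else 0) =
      blocks σ (x + 1) P + (if P ≤ pos σ x ∧ x + 1 < word σ (pos σ x + 1) then 1 else 0) := by
  have hp := one_le_pos σ x
  have hp' := pos_le σ x
  -- The two correction terms are written as sums supported at the positions just before and at `x`,
  -- so that the identity can be checked summand by summand.
  have h1 : (if P < pos σ x ∧ word σ (pos σ x - 1) < x + 1 then 1 else 0) =
      ∑ j ∈ Ico P (m + 1), if j = pos σ x - 1 then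
        (if word σ (pos σ x - 1) < x + 1 then 1 else 0) else 0 := by
    rw [sum_ite_eq']
    by_cases h : P < pos σ x
    · rw [if_pos (mem_Ico.2 (by omega))]
      simp [h]
    · rw [if_neg (fun h' => h h'.1), if_neg (by rw [mem_Ico]; omega)]
  have h2 : (if P ≤ pos σ x ∧ x + 1 < word σ (pos σ x + 1) then 1 else 0) =
      ∑ j ∈ Ico P (m + 1), if j = pos σ x then
        (if x + 1 < word σ (pos σ x + 1) then 1 else 0) else 0 := by
    rw [sum_ite_eq']
    by_cases h : P ≤ pos σ x
    · rw [if_pos (mem_Ico.2 (by omega))]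
      simp [h]
    · rw [if_neg (fun h' => h h'.1), if_neg (by rw [mem_Ico]; omega)]
  unfold blocks
  rw [h1, h2, ← sum_add_distrib, ← sum_add_distrib]
  refine sum_congr rfl fun j _ => ?_
  have hj := word_eq_iff σ x j
  have hj' := word_eq_iff σ x (j + 1)
  by_cases e : j = pos σ x
  · have e1 : j ≠ pos σ x - 1 := by omega
    have e2 := hj.2 e
    subst e
    rw [if_neg e1, if_pos rfl, if_neg (show ¬ (word σ (pos σ x) < x + 1 ∧ _) by omega)]
    split_ifs <;> omega
  · by_cases e' : j = pos σ x - 1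
    · have e1 : j + 1 = pos σ x := by omega
      have e2 := hj'.2 e1
      rw [if_pos e', if_neg e, ← e', e2]
      split_ifs <;> omega
    · have e1 : j + 1 ≠ pos σ x := by omega
      rw [if_neg e, if_neg e']
      have := mt hj.1 e
      have := mt hj'.1 e1
      split_ifs <;> omega

/-! ### Labels as block counts, and the relative order of letters -/

theorem two13_eq_blocks (x : Fin m) : two13 σ x = blocks σ (x + 1) (pos σ x) := by
  unfold two13 blocks
  rw [← card_filter]
  apply card_bij (fun (j : Fin m) _ => (j : ℕ) + 1)
  · intro j hj
    simp only [mem_filter, mem_univ, true_and, mem_Ico, pos, Fin.lt_def] at hj ⊢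
    obtain ⟨k, hk, h1, h2, h3⟩ := hj
    rw [hk, word_succ, ← hk, word_succ]
    omega
  · intro a _ b _ h
    exact Fin.ext (by omega)
  · intro j hj
    simp only [mem_filter, mem_Ico] at hj
    obtain ⟨⟨h1, h2⟩, h3, h4⟩ := hj
    have hp := one_le_pos σ x
    -- The boundary value `σ(m+1) = 0` cannot start a block, so the extra index `m` of the sum
    -- contributes nothing.
    have hjm : j < m := by
      by_contra h
      have : j = m := by omega
      rw [this, word_succ_self] at h4
      omega
    have hne : j ≠ pos σ x := fun h => by rw [h, word_pos] at h3; omega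
    have hne' : j + 1 ≠ pos σ x := by omega
    rw [Ne, ← word_eq_iff] at hne'
    have e1 := word_succ σ ⟨j - 1, by omega⟩
    have e2 := word_succ σ ⟨j, hjm⟩
    simp only [Nat.sub_add_cancel (hp.trans h1)] at e1 e2
    refine ⟨⟨j - 1, by omega⟩, ?_, by simp only; omega⟩
    simp only [mem_filter, mem_univ, true_and, Fin.lt_def]
    refine ⟨⟨j, hjm⟩, by simp only; omega, ?_, by omega, by omega⟩
    unfold pos at h1 hne
    omega

/-- Between a letter less than `x` and `x`, a block starts. -/
theorem blocks_pos_lt {P : ℕ} (x : Fin m) (hP : word σ P < x + 1) (h : P < pos σ x) :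
    blocks σ (x + 1) (pos σ x) < blocks σ (x + 1) P := by
  -- A discrete intermediate value argument: walking from a smaller letter to `x`, the word must at
  -- some point rise to at least `x`.
  have key : ∀ d k, k + d = pos σ x → word σ k < x + 1 → k < pos σ x →
      ∃ j, k ≤ j ∧ j < pos σ x ∧ word σ j < x + 1 ∧ x + 1 ≤ word σ (j + 1) := by
    intro d
    induction d with
    | zero => intro k hk _ hlt; omega
    | succ d ih =>
      intro k hk hw hlt
      by_cases h' : x + 1 ≤ word σ (k + 1)
      · exact ⟨k, le_rfl, hlt, hw, h'⟩
      · have hne : k + 1 ≠ pos σ x := by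
          rw [Ne, ← word_eq_iff]
          omega
        obtain ⟨j, h1, h2⟩ := ih (k + 1) (by omega) (by omega) (by omega)
        exact ⟨j, by omega, h2⟩
  obtain ⟨j, h1, h2, h3⟩ := key (pos σ x - P) P (by omega) hP h
  have hp' := pos_le σ x
  refine sum_lt_sum_of_subset (Ico_subset_Ico_left h.le) (i := j) (mem_Ico.2 (by omega))
    (fun h => by rw [mem_Ico] at h; omega) ?_ (fun _ _ _ => Nat.zero_le _)
  rw [if_pos h3]
  exact one_pos

/-- The relative order of the letters `x < y` is determined by `(2-13)_y σ`. -/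
theorem pos_lt_pos_iff {x y : Fin m} (h : x < y) :
    pos σ x < pos σ y ↔ two13 σ y < blocks σ (y + 1) (pos σ x) := by
  rw [two13_eq_blocks]
  refine ⟨blocks_pos_lt σ y ?_, fun hlt => ?_⟩
  · rw [word_pos]
    rw [Fin.lt_def] at h
    omega
  · by_contra hle
    exact (blocks_anti σ (y + 1) (not_lt.1 hle)).not_gt hlt

/-- At the lowest threshold the whole word is a single block, which starts at the boundary zero. -/
theorem blocks_one_zero (hm : 0 < m) : blocks σ 1 0 = 1 := by
  unfold blocks
  rw [sum_eq_single_of_mem 0 (mem_Ico.2 (by omega))]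
  · rw [if_pos]
    rw [word_zero, word_succ σ ⟨0, hm⟩]
    omega
  · intro j hj hj0
    rw [mem_Ico] at hj
    rw [if_neg]
    rintro ⟨h1, -⟩
    have := word_succ σ ⟨j - 1, by omega⟩
    simp only [Nat.sub_add_cancel (Nat.pos_of_ne_zero hj0)] at this
    omega

/-- At the highest threshold the only block is the largest letter alone. -/
theorem blocks_self_zero (hm : 0 < m) : blocks σ m 0 = 1 := by
  obtain ⟨n, rfl⟩ : ∃ n, m = n + 1 := ⟨m - 1, by omega⟩
  have hp := one_le_pos σ (Fin.last n)
  have hp' := pos_le σ (Fin.last n)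
  have hw := word_eq_iff σ (Fin.last n)
  rw [Fin.val_last] at hw
  unfold blocks
  rw [sum_eq_single_of_mem (pos σ (Fin.last n) - 1) (mem_Ico.2 (by omega))]
  · have h1 := (hw (pos σ (Fin.last n) - 1 + 1)).2 (by omega)
    have h2 := mt (hw (pos σ (Fin.last n) - 1)).1 (by omega)
    have h3 := word_le σ (pos σ (Fin.last n) - 1)
    rw [if_pos (by omega)]
  · intro j hj hj0
    have h1 := mt (hw (j + 1)).1 (by omega)
    have h3 := word_le σ (j + 1)
    rw [if_neg (by omega)]

theorem two13_last {n : ℕ} (σ : Equiv.Perm (Fin (n + 1))) : two13 σ (Fin.last n) = 0 := by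
  unfold two13
  rw [card_eq_zero, filter_eq_empty_iff]
  rintro j - ⟨k, -, -, -, h⟩
  exact (Fin.le_last _).not_gt h

/-! ### Steps and neighbours -/

/-- Together with `psiFV_rise_right` this translates the four steps into two independent comparisons
with the neighbours, the form in which `blocks_succ` uses them. -/
theorem psiFV_rise_left {n : ℕ} (σ : Equiv.Perm (Fin (n + 1))) (i : Fin n) :
    word σ (pos σ i.castSucc - 1) < i + 1 ↔
      (psiFV σ).1 i = Step.D ∨ (psiFV σ).1 i = Step.Lb := by
  have h := word_pos σ i.castSucc
  have hp := one_le_pos σ i.castSucc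
  have h1 := mt (word_eq_iff σ i.castSucc (pos σ i.castSucc - 1)).1 (by omega)
  have h2 := mt (word_eq_iff σ i.castSucc (pos σ i.castSucc + 1)).1 (by omega)
  rw [Fin.val_castSucc] at h h1 h2
  simp only [psiFV, IsValley, IsPeak, IsDoubleAscent, h]
  split_ifs <;> simp <;> omega

theorem psiFV_rise_right {n : ℕ} (σ : Equiv.Perm (Fin (n + 1))) (i : Fin n) :
    i + 1 < word σ (pos σ i.castSucc + 1) ↔
      (psiFV σ).1 i = Step.U ∨ (psiFV σ).1 i = Step.Lb := by
  have h := word_pos σ i.castSucc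
  have hp := one_le_pos σ i.castSucc
  have h1 := mt (word_eq_iff σ i.castSucc (pos σ i.castSucc - 1)).1 (by omega)
  have h2 := mt (word_eq_iff σ i.castSucc (pos σ i.castSucc + 1)).1 (by omega)
  rw [Fin.val_castSucc] at h h1 h2
  simp only [psiFV, IsValley, IsPeak, IsDoubleAscent, h]
  split_ifs <;> simp <;> omega

theorem psiFV_snd {n : ℕ} (σ : Equiv.Perm (Fin (n + 1))) (i : Fin n) :
    (psiFV σ).2 i = two13 σ i.castSucc := rfl

/-! ### Injectivity of `ψ_FV` -/

theorem symm_lt_symm_iff (x y : Fin m) : σ.symm x < σ.symm y ↔ pos σ x < pos σ y := by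
  simp [pos]

/-- The history determines these counts by induction on the threshold. The label of `x` starts the
induction. To raise the threshold past a letter `i`, `blocks_succ` needs the step of `i` and the
order of `x` and `i`; that order is read off from the label of `i` and the count already known. -/
theorem psiFV_blocks_eq {n : ℕ} {σ σ' : Equiv.Perm (Fin (n + 1))} (h : psiFV σ = psiFV σ')
    (x : Fin (n + 1)) (y : ℕ) (hxy : x + 1 ≤ y) (hy : y ≤ n + 1) :
    blocks σ y (pos σ x) = blocks σ' y (pos σ' x) := by
  -- The largest letter carries no label in the history, but nothing exceeds it, so its count is
  -- zero.
  have h13 : ∀ z, two13 σ z = two13 σ' z := by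
    intro z
    induction z using Fin.lastCases with
    | last => rw [two13_last, two13_last]
    | cast i => rw [← psiFV_snd, ← psiFV_snd, h]
  induction y, hxy using Nat.le_induction with
  | base => rw [← two13_eq_blocks, ← two13_eq_blocks, h13]
  | succ y hxy ih =>
    obtain ⟨i, rfl⟩ : ∃ i : Fin n, y = i + 1 := ⟨⟨y - 1, by omega⟩, by simp only; omega⟩
    have ih := ih (by omega)
    have e := blocks_succ σ i.castSucc (pos σ x)
    have e' := blocks_succ σ' i.castSucc (pos σ' x)
    simp only [Fin.val_castSucc, psiFV_rise_left, psiFV_rise_right, h, ih] at e e'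
    have hcmp : (pos σ x < pos σ i.castSucc ↔ pos σ' x < pos σ' i.castSucc) ∧
        (pos σ x ≤ pos σ i.castSucc ↔ pos σ' x ≤ pos σ' i.castSucc) := by
      rcases lt_or_eq_of_le (show x ≤ i.castSucc by
        rw [Fin.le_def, Fin.val_castSucc]; omega) with hlt | rfl
      · have a := pos_lt_pos_iff σ hlt
        have a' := pos_lt_pos_iff σ' hlt
        rw [Fin.val_castSucc, h13] at a
        rw [Fin.val_castSucc] at a'
        rw [ih] at a
        have hne : pos σ x ≠ pos σ i.castSucc := fun h => by
          simp only [pos, add_left_inj, Fin.val_inj, EmbeddingLike.apply_eq_iff_eq] at h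
          exact hlt.ne h
        have hne' : pos σ' x ≠ pos σ' i.castSucc := fun h => by
          simp only [pos, add_left_inj, Fin.val_inj, EmbeddingLike.apply_eq_iff_eq] at h
          exact hlt.ne h
        refine ⟨a.trans a'.symm, ?_⟩
        rw [le_iff_lt_or_eq, le_iff_lt_or_eq, a, a']
        tauto
      · simp
    simp only [hcmp.1, hcmp.2] at e
    change blocks σ (i + 2) _ = blocks σ' (i + 2) _
    omega

theorem psiFV_injective (n : ℕ) : Function.Injective (psiFV (n := n)) := by
  intro σ σ' h
  have hlt : ∀ x y : Fin (n + 1), x < y → (σ.symm x < σ.symm y ↔ σ'.symm x < σ'.symm y) := by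
    intro x y hxy
    have hy : two13 σ y = two13 σ' y := by
      induction y using Fin.lastCases with
      | last => rw [two13_last, two13_last]
      | cast i => rw [← psiFV_snd, ← psiFV_snd, h]
    rw [symm_lt_symm_iff, symm_lt_symm_iff, pos_lt_pos_iff σ hxy, pos_lt_pos_iff σ' hxy, hy,
      psiFV_blocks_eq h x (y + 1) (by rw [Fin.lt_def] at hxy; omega) (by omega)]
  -- Both words place every pair of letters in the same order, so the map matching positions of
  -- equal letters is increasing, hence the identity.
  have hmono : StrictMono (σ.trans σ'.symm) := by
    intro a b hab
    rw [Equiv.trans_apply, Equiv.trans_apply]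
    rcases lt_trichotomy (σ a) (σ b) with h1 | h1 | h1
    · rw [← hlt _ _ h1]
      simpa using hab
    · exact absurd (σ.injective h1) hab.ne
    · rw [← not_le, le_iff_lt_or_eq, ← hlt _ _ h1]
      simp [hab.not_gt, hab.ne']
  have hid : (σ.trans σ'.symm : Fin (n + 1) → Fin (n + 1)) = id := by
    rw [← hmono.range_inj strictMono_id, Set.range_id, (σ.trans σ'.symm).range_eq_univ]
  ext1 a
  have := congrFun hid a
  rw [Equiv.trans_apply, Equiv.symm_apply_eq] at this
  exact this

end

/-! ### Counting Laguerre histories -/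

/-- The height difference of a step. -/
def Step.rise : Step → ℤ
  | U => 1
  | D => -1
  | Lb => 0
  | Lr => 0

theorem height_eq_sum {n : ℕ} (s : Fin n → Step) (k : ℕ) :
    height s k = ∑ j : Fin n, if (j : ℕ) < k then (s j).rise else 0 := by
  unfold height
  rw [card_filter, card_filter]
  push_cast
  rw [← sum_sub_distrib]
  refine sum_congr rfl fun j _ => ?_
  by_cases h : (j : ℕ) < k <;> cases hs : s j <;> simp [h, Step.rise]

theorem height_zero {n : ℕ} (s : Fin n → Step) : height s 0 = 0 := by
  simp [height_eq_sum]

theorem height_succ {n : ℕ} (s : Fin n → Step) (k : Fin n) :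
    height s (k + 1) = height s k + (s k).rise := by
  have : (s k).rise = ∑ j : Fin n, if j = k then (s j).rise else 0 := by simp
  rw [height_eq_sum, height_eq_sum, this, ← sum_add_distrib]
  refine sum_congr rfl fun j _ => ?_
  simp only [Fin.ext_iff]
  split_ifs <;> omega

theorem height_cons {n : ℕ} (a : Step) (s : Fin n → Step) (k : ℕ) :
    height (Fin.cons a s : Fin (n + 1) → Step) (k + 1) = a.rise + height s k := by
  simp [height_eq_sum, Fin.sum_univ_succ]

/-- The Laguerre histories of length `n` that start at height `h`. -/
def laguerreSuffixes (n : ℕ) (h : ℤ) : Set ((Fin n → Step) × (Fin n → ℕ)) :=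
  {sp | (∀ k ≤ n, 0 ≤ h + height sp.1 k) ∧ h + height sp.1 n = 0 ∧
    ∀ i : Fin n, (sp.2 i : ℤ) ≤ h + height sp.1 i}

theorem laguerreSuffixes_zero (n : ℕ) : laguerreSuffixes n 0 = laguerreHistories n := by
  simp [laguerreSuffixes, laguerreHistories, IsTwoMotzkin, and_assoc]

theorem laguerreSuffixes_neg (n : ℕ) {h : ℤ} (hh : h < 0) : laguerreSuffixes n h = ∅ := by
  rw [Set.eq_empty_iff_forall_notMem]
  rintro sp ⟨h1, -⟩
  have := h1 0 (Nat.zero_le _)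
  rw [height_zero] at this
  omega

theorem tail_mem_laguerreSuffixes {n : ℕ} {h : ℤ} {a : Step} {s : Fin n → Step} {b : ℕ}
    {p : Fin n → ℕ} (hm : ((Fin.cons a s, Fin.cons b p) :
      (Fin (n + 1) → Step) × (Fin (n + 1) → ℕ)) ∈ laguerreSuffixes (n + 1) h) :
    (b : ℤ) ≤ h ∧ (s, p) ∈ laguerreSuffixes n (h + a.rise) := by
  obtain ⟨h1, h2, h3⟩ := hm
  refine ⟨?_, ?_, ?_, ?_⟩
  · simpa [height_zero] using h3 0
  · intro k hk
    have := h1 (k + 1) (by omega)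
    rw [height_cons] at this
    simp only
    omega
  · rw [height_cons] at h2
    simp only
    omega
  · intro i
    have := h3 i.succ
    simp only [Fin.cons_succ, Fin.val_succ, height_cons] at this
    simp only
    omega

/-- Pascal's rule applied twice turns the three binomials into `C(n+2, h+2)`, and absorption trades
the factor `h + 2` for `n + 2`. -/
theorem factorial_mul_choose_rec (n h : ℕ) :
    (h + 2) * ((n + 1).factorial * n.choose (h + 2) + 2 * ((n + 1).factorial * n.choose (h + 1)) +
      (n + 1).factorial * n.choose h) = (n + 2).factorial * (n + 1).choose (h + 1) := by
  have h1 := Nat.add_one_mul_choose_eq (n + 1) (h + 1)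
  have h2 : (n + 2).choose (h + 2) = n.choose h + 2 * n.choose (h + 1) + n.choose (h + 2) := by
    rw [Nat.choose_succ_succ, Nat.choose_succ_succ n h, Nat.choose_succ_succ n (h + 1)]
    ring
  rw [h2] at h1
  rw [Nat.factorial_succ (n + 1)]
  linear_combination (n + 1).factorial * h1.symm

theorem factorial_mul_choose_rec_zero (n : ℕ) :
    (n + 1).factorial * n.choose 1 + 2 * ((n + 1).factorial * n.choose 0) =
      (n + 2).factorial * (n + 1).choose 0 := by
  rw [Nat.factorial_succ (n + 1)]
  simp
  ring

/-- There are at most `(n+1)! * C(n, h)` Laguerre histories of length `n` from height `h`. -/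
theorem exists_finset_laguerreSuffixes (n : ℕ) : ∀ h : ℕ,
    ∃ S : Finset ((Fin n → Step) × (Fin n → ℕ)), laguerreSuffixes n h ⊆ S ∧
      #S ≤ (n + 1).factorial * n.choose h := by
  induction n with
  | zero =>
    intro h
    rcases h with _ | h
    · exact ⟨univ, by simp, by simp⟩
    · refine ⟨∅, ?_, by simp⟩
      rintro sp ⟨-, h2, -⟩
      rw [height_zero] at h2
      push_cast at h2
      omega
  | succ n ih =>
    intro h
    choose S hS hc using ih
    -- A down step from height zero leaves no admissible suffix, so its family is empty.
    let D : Finset ((Fin n → Step) × (Fin n → ℕ)) := if h = 0 then ∅ else S (h - 1)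
    let T : Step → Finset ((Fin n → Step) × (Fin n → ℕ)) := fun a =>
      match a with
      | .U => S (h + 1)
      | .D => D
      | .Lb => S h
      | .Lr => S h
    have hT : ∀ a, laguerreSuffixes n (h + a.rise) ⊆ T a := by
      rintro (_ | _ | _ | _)
      · exact_mod_cast hS (h + 1)
      · rcases h with _ | h
        · rw [laguerreSuffixes_neg n (by simp [Step.rise])]
          exact Set.empty_subset _
        · have := hS h
          have h' : ((h + 1 : ℕ) : ℤ) + Step.D.rise = h := by simp [Step.rise]
          rw [h']
          simpa [T, D] using this
      · simpa [Step.rise, T] using hS h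
      · simpa [Step.rise, T] using hS h
    -- A history from height `h` consists of its first step, one of the `h + 1` possible first
    -- labels, and a suffix from the new height.
    let F : Step → Finset ((Fin (n + 1) → Step) × (Fin (n + 1) → ℕ)) := fun a =>
      (range (h + 1) ×ˢ T a).image fun q => (Fin.cons a q.2.1, Fin.cons q.1 q.2.2)
    have hF : ∀ a, #(F a) ≤ (h + 1) * #(T a) := fun a =>
      card_image_le.trans (by rw [card_product, card_range])
    refine ⟨F .U ∪ F .D ∪ F .Lb ∪ F .Lr, ?_, ?_⟩
    · rintro ⟨s, p⟩ hsp
      obtain ⟨a, s, rfl⟩ : ∃ a s', s = Fin.cons a s' :=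
        ⟨s 0, Fin.tail s, (Fin.cons_self_tail s).symm⟩
      obtain ⟨b, p, rfl⟩ : ∃ b p', p = Fin.cons b p' :=
        ⟨p 0, Fin.tail p, (Fin.cons_self_tail p).symm⟩
      obtain ⟨hb, hm⟩ := tail_mem_laguerreSuffixes hsp
      have hmem : (Fin.cons a s, Fin.cons b p) ∈ F a := by
        refine mem_image.2 ⟨(b, s, p), mem_product.2 ⟨mem_range.2 ?_, hT a hm⟩, rfl⟩
        simp only
        omega
      simp only [coe_union, Set.mem_union, mem_coe]
      cases a <;> tauto
    · have h1 : #(F .U ∪ F .D ∪ F .Lb ∪ F .Lr) ≤ #(F .U) + #(F .D) + #(F .Lb) + #(F .Lr) := by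
        have a1 := card_union_le (F .U ∪ F .D ∪ F .Lb) (F .Lr)
        have a2 := card_union_le (F .U ∪ F .D) (F .Lb)
        have a3 := card_union_le (F .U) (F .D)
        omega
      have h2 : #(F .U ∪ F .D ∪ F .Lb ∪ F .Lr) ≤ (h + 1) * (#(S (h + 1)) + 2 * #(S h) + #D) := by
        refine h1.trans ((add_le_add (add_le_add (add_le_add (hF _) (hF _)) (hF _)) (hF _)).trans
          (le_of_eq ?_))
        simp only [T]
        ring
      refine h2.trans ?_
      rcases h with _ | h
      · rw [← factorial_mul_choose_rec_zero]
        have := hc 0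
        have := hc 1
        simp only [D, if_true, card_empty, zero_add]
        omega
      · rw [← factorial_mul_choose_rec]
        refine Nat.mul_le_mul_left _ (add_le_add (add_le_add (hc _)
          (Nat.mul_le_mul_left _ (hc _))) ?_)
        simpa [D] using hc h

theorem exists_finset_laguerreHistories (n : ℕ) :
    ∃ S : Finset ((Fin n → Step) × (Fin n → ℕ)), laguerreHistories n ⊆ S ∧
      #S ≤ (n + 1).factorial := by
  obtain ⟨S, hS, hc⟩ := exists_finset_laguerreSuffixes n 0
  rw [Nat.cast_zero, laguerreSuffixes_zero] at hS
  exact ⟨S, hS, by simpa using hc⟩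

section

/-! ### `ψ_FV` is a bijection onto the Laguerre histories -/

/-- Passing a valley creates one block, passing a peak removes one, and a double ascent or descent
leaves the number unchanged. This is `blocks_succ` from position zero. -/
theorem height_psiFV {n : ℕ} (σ : Equiv.Perm (Fin (n + 1))) (k : ℕ) (hk : k ≤ n) :
    height (psiFV σ).1 k + 1 = blocks σ (k + 1) 0 := by
  induction k with
  | zero => rw [height_zero, blocks_one_zero σ (Nat.succ_pos n)]; rfl
  | succ k ih =>
    have ih := ih (by omega)
    let i : Fin n := ⟨k, by omega⟩
    have e := blocks_succ σ i.castSucc 0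
    have hp := one_le_pos σ i.castSucc
    have hs := height_succ (psiFV σ).1 i
    simp only [Fin.val_castSucc, psiFV_rise_left, psiFV_rise_right, Nat.zero_le, true_and,
      show 0 < pos σ i.castSucc from hp] at e
    change blocks σ (k + 2) 0 + _ = blocks σ (k + 1) 0 + _ at e
    change height (psiFV σ).1 (k + 1) = height (psiFV σ).1 k + _ at hs
    change _ = (blocks σ (k + 2) 0 : ℤ)
    cases h : (psiFV σ).1 i <;> simp [h, Step.rise] at e hs <;> omega

/-- The block containing `x` does not start to the right of `x`, so the label is strictly less than
the number of blocks, that is, at most the height. In particular there is always a block, so heights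
are nonnegative. -/
theorem psiFV_mem_laguerreHistories {n : ℕ} (σ : Equiv.Perm (Fin (n + 1))) :
    psiFV σ ∈ laguerreHistories n := by
  have hlt : ∀ x : Fin (n + 1), two13 σ x < blocks σ (x + 1) 0 := by
    intro x
    rw [two13_eq_blocks]
    exact blocks_pos_lt σ x (by rw [word_zero]; omega) (one_le_pos σ x)
  refine ⟨⟨fun k hk => ?_, ?_⟩, fun i => ?_⟩
  · have h1 := height_psiFV σ k hk
    have h2 := hlt ⟨k, by omega⟩
    simp only at h2
    omega
  · have h1 := height_psiFV σ n le_rfl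
    rw [blocks_self_zero σ (Nat.succ_pos n)] at h1
    omega
  · have h1 := height_psiFV σ i i.2.le
    have h2 := hlt i.castSucc
    rw [Fin.val_castSucc] at h2
    rw [psiFV_snd]
    omega

theorem psiFV_bijOn (n : ℕ) : Set.BijOn (psiFV (n := n)) Set.univ (laguerreHistories n) := by
  refine ⟨fun σ _ => psiFV_mem_laguerreHistories σ, (psiFV_injective n).injOn, ?_⟩
  obtain ⟨S, hS, hc⟩ := exists_finset_laguerreHistories n
  classical
  -- The injective image already has `(n+1)!` elements, so it fills the finite set that bounds the
  -- histories.
  have h1 : univ.image (psiFV (n := n)) = S := by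
    apply eq_of_subset_of_card_le
    · intro x hx
      obtain ⟨σ, -, rfl⟩ := mem_image.1 hx
      exact mem_coe.1 (hS (psiFV_mem_laguerreHistories σ))
    · rwa [card_image_of_injective _ (psiFV_injective n), card_univ, Fintype.card_perm,
        Fintype.card_fin]
  intro x hx
  have := mem_coe.1 (hS hx)
  rw [← h1] at this
  obtain ⟨σ, -, rfl⟩ := mem_image.1 this
  exact ⟨σ, Set.mem_univ _, rfl⟩

/-! ### The permutation `σ̂` -/

variable {m : ℕ} (σ : Equiv.Perm (Fin m))

/-- The appended letter `1` of `σ̂` plays the role of the boundary value `σ(m+1) = 0`. The increment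
of the other letters is absorbed by comparing the zero-based value in `σ̂` with the one-based value
in `word σ`. -/
theorem val_hat (k : Fin (m + 1)) : (hat σ k : ℕ) = word σ (k + 1) := by
  induction k using Fin.lastCases with
  | last =>
    rw [Fin.val_last, word_succ_self]
    simp [hat]
  | cast i =>
    rw [Fin.val_castSucc, word_succ]
    simp [hat]

theorem val_hat_symm_succ (i : Fin m) : ((hat σ).symm i.succ : ℕ) + 1 = pos σ i := by
  simp [hat, pos]

theorem succ_mem_descTops_hat (i : Fin m) :
    i.succ ∈ descTops (hat σ) ↔ word σ (pos σ i + 1) < i + 1 := by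
  have hp := pos_le σ i
  simp only [descTops, mem_filter, mem_univ, true_and, Fin.lt_def, val_hat, Fin.ext_iff,
    Fin.val_succ]
  constructor
  · rintro ⟨a, b, h1, h2, h3⟩
    rw [eq_comm, word_eq_iff] at h3
    rw [h3, word_pos, ← h1, h3] at h2
    exact h2
  · intro h
    refine ⟨⟨pos σ i - 1, by omega⟩, ⟨pos σ i, by omega⟩, ?_, ?_, ?_⟩ <;>
      simp [Nat.sub_add_cancel (one_le_pos σ i), word_pos, h]

theorem succ_mem_descBots_hat (i : Fin m) :
    i.succ ∈ descBots (hat σ) ↔ i + 1 < word σ (pos σ i - 1) := by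
  have hp := pos_le σ i
  have hp1 := one_le_pos σ i
  simp only [descBots, mem_filter, mem_univ, true_and, Fin.lt_def, val_hat, Fin.ext_iff,
    Fin.val_succ]
  constructor
  · rintro ⟨a, b, h1, h2, h3⟩
    rw [eq_comm, word_eq_iff] at h3
    rwa [h3, word_pos, show (a : ℕ) + 1 = pos σ i - 1 by omega] at h2
  · intro h
    -- A first letter has left neighbour zero and so cannot be a descent bottom, which matches `σ̂`
    -- having no position before the first.
    have h2 : 2 ≤ pos σ i := by
      by_contra h2
      rw [show pos σ i - 1 = 0 by omega, word_zero] at h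
      omega
    refine ⟨⟨pos σ i - 2, by omega⟩, ⟨pos σ i - 1, by omega⟩, ?_, ?_, ?_⟩
    · simp only
      omega
    · simp only
      rw [Nat.sub_add_cancel hp1, word_pos, show pos σ i - 2 + 1 = pos σ i - 1 by omega]
      exact h
    · simp only
      rw [Nat.sub_add_cancel hp1, word_pos]

theorem two31_hat_succ (i : Fin m) : two31 (hat σ) i.succ =
    ∑ j ∈ Ico (pos σ i) (m + 1),
      if word σ (j + 1) < i + 1 ∧ i + 1 < word σ j then 1 else 0 := by
  unfold two31
  rw [← card_filter]
  have hp := one_le_pos σ i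
  apply card_bij (fun (j : Fin (m + 1)) _ => (j : ℕ) + 1)
  · intro j hj
    simp only [mem_filter, mem_univ, true_and, mem_Ico, Fin.lt_def, val_hat, Fin.val_succ] at hj ⊢
    obtain ⟨k, hk, h1, h2, h3⟩ := hj
    have := val_hat_symm_succ σ i
    rw [hk]
    refine ⟨by omega, h2, ?_⟩
    rwa [← hk]
  · intro a _ b _ h
    exact Fin.ext (by omega)
  · intro j hj
    simp only [mem_filter, mem_Ico] at hj
    obtain ⟨⟨h1, h2⟩, h3, h4⟩ := hj
    have hne : j ≠ pos σ i := fun h => by rw [h, word_pos] at h4; omega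
    have := val_hat_symm_succ σ i
    refine ⟨⟨j - 1, by omega⟩, ?_, by simp only; omega⟩
    simp only [mem_filter, mem_univ, true_and, Fin.lt_def, val_hat, Fin.val_succ]
    refine ⟨⟨j, h2⟩, by simp only; omega, by omega, h3, ?_⟩
    rwa [Nat.sub_add_cancel (hp.trans h1)]

/-- To the right of `i`, the word rises through `i` as often as it descends through `i`. -/
theorem two31_hat_succ_eq_blocks (i : Fin m) :
    two31 (hat σ) i.succ = blocks σ (i + 2) (pos σ i) := by
  have hp := pos_le σ i
  -- The indicator of being above `i` vanishes at `i` and at the final zero, so its increments,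
  -- rises minus descents, sum to zero.
  have htel := sum_Ico_sub (fun j => if (i : ℕ) + 1 < word σ j then (1 : ℤ) else 0)
    (show pos σ i ≤ m + 1 by omega)
  simp only [word_succ_self, word_pos, lt_irrefl, Nat.not_lt_zero, if_false, sub_zero] at htel
  rw [two31_hat_succ, blocks, ← Nat.cast_inj (R := ℤ), eq_comm, ← sub_eq_zero, ← htel]
  push_cast
  rw [← sum_sub_distrib]
  refine sum_congr rfl fun j hj => ?_
  rw [mem_Ico] at hj
  have h1 := mt (word_eq_iff σ i (j + 1)).1 (by omega)
  split_ifs <;> omega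

/-- The rises through `i` include the one that starts at `i` itself when its right neighbour is
larger. `(2-13)` does not count that one, whence the correction. -/
theorem two31_hat_succ_eq_two13 (i : Fin m) : two31 (hat σ) i.succ =
    two13 σ i + if i.succ ∈ descTops (hat σ) then 0 else 1 := by
  have h := blocks_succ σ i (pos σ i)
  rw [if_neg (fun h => lt_irrefl _ h.1), add_zero] at h
  rw [two31_hat_succ_eq_blocks, h, two13_eq_blocks]
  congr 1
  have h1 := mt (word_eq_iff σ i (pos σ i + 1)).1 (by omega)
  simp only [succ_mem_descTops_hat, le_refl, true_and]
  split_ifs <;> omega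

/-! ### The comparison `ψ_FV = ψ_YZL ∘ Ψ` -/

theorem val_Psi (i : Fin m) : (Psi σ i : ℕ) = Phi (hat σ) i.succ := rfl

theorem val_Psi_symm (i : Fin m) :
    ((Psi σ).symm i : ℕ) + 1 = (Phi (hat σ)).symm i.castSucc := by
  have h : ((Psi σ).symm i).succ = (Phi (hat σ)).symm i.castSucc := 
    Fin.succ_pred _ (Phi_hat_symm_castSucc_ne σ i)
  rw [← h, Fin.val_succ]

theorem lt_Psi_iff (i : Fin m) : i < Psi σ i ↔ i.succ ∉ descTops (hat σ) := by
  rw [← (isPhi_Phi (hat σ)).apply_lt_iff, Fin.lt_def, Fin.lt_def, val_Psi, Fin.val_succ]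
  omega

/-- Dropping `τ(1)` moves every remaining position down by one, which turns the strict inequality of
`IsPhi.lt_symm_iff` into a weak one. -/
theorem le_Psi_symm_iff {n : ℕ} (σ : Equiv.Perm (Fin (n + 1))) (i : Fin n) :
    i.succ ≤ (Psi σ).symm i.succ ↔ i.castSucc.succ ∈ descBots (hat σ) := by
  rw [← (isPhi_Phi (hat σ)).lt_symm_iff, Fin.le_def, Fin.lt_def, Fin.succ_castSucc,
    ← val_Psi_symm, Fin.val_castSucc]
  omega

/-- Only one of the two clauses of `nest` can apply, according to whether `i.succ` is a descent top
of `σ̂`. It is then an unrestricted inversion count of `τ`, up to the deleted first position. -/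
theorem nest_Psi (i : Fin m) : nest (Psi σ) i = two13 σ i := by
  have hP := isPhi_Phi (hat σ)
  have h13 := two31_hat_succ_eq_two13 σ i
  by_cases hi : i.succ ∈ descTops (hat σ)
  · have h := hP.card_of_mem hi
    rw [if_pos hi, add_zero] at h13
    -- Position zero is not to the right of `i.succ`, so deleting it loses nothing.
    rw [h13, Fin.card_filter_univ_succ, if_neg (by simp)] at h
    rw [← h, nest]
    congr 1
    ext j
    have hle := mt (lt_Psi_iff σ i).1 (not_not.2 hi)
    simp only [mem_filter, mem_univ, true_and, Fin.val_succ, Fin.lt_def, Fin.le_def,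
      val_Psi] at hle ⊢
    omega
  · have h := hP.card_of_notMem hi
    rw [if_neg hi] at h13
    -- Position zero carries the maximal letter and is always counted here; deleting it cancels the
    -- one by which `(2-31)` exceeds `(2-13)`.
    have h0 : (0 : Fin (m + 1)) < i.succ ∧ Phi (hat σ) i.succ < Phi (hat σ) 0 := by
      rw [Phi_hat_zero]
      exact ⟨Fin.succ_pos i, Fin.lt_last_iff_ne_last.2 (Phi_hat_succ_ne σ i)⟩
    rw [h13, Fin.card_filter_univ_succ, if_pos h0, add_left_inj] at h
    rw [← h, nest]
    congr 1
    ext j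
    have hlt := (lt_Psi_iff σ i).2 hi
    simp only [mem_filter, mem_univ, true_and, Fin.val_succ, Fin.lt_def, Fin.le_def,
      val_Psi] at hlt ⊢
    omega

/-- The excedance condition at `i` says that the right neighbour of `i` is larger, and the condition
on `i + 1` says that the left neighbour is larger. The four combinations are the four cases of
`psiFV`. -/
theorem psiFV_eq_psiYZL_Psi {n : ℕ} (σ : Equiv.Perm (Fin (n + 1))) :
    psiFV σ = psiYZL (Psi σ) := by
  refine Prod.ext (funext fun i => ?_) (funext fun i => (nest_Psi σ i.castSucc).symm)
  have h := word_pos σ i.castSucc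
  have hp := one_le_pos σ i.castSucc
  have h1 := mt (word_eq_iff σ i.castSucc (pos σ i.castSucc - 1)).1 (by omega)
  have h2 := mt (word_eq_iff σ i.castSucc (pos σ i.castSucc + 1)).1 (by omega)
  have h3 := lt_Psi_iff σ i.castSucc
  have h4 := le_Psi_symm_iff σ i
  rw [succ_mem_descTops_hat] at h3
  rw [succ_mem_descBots_hat] at h4
  simp only [psiFV, psiYZL, scval, scpeak, sde, mem_filter, mem_univ, true_and, ge_iff_le,
    gt_iff_lt, ← not_lt (a := i.castSucc), ← not_le (b := (Psi σ).symm i.succ), h3, h4,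
    IsValley, IsPeak, IsDoubleAscent, h]
  split_ifs <;> first | rfl | omega

end

end LagHist

theorem mainTheorem11 (n : ℕ) :
    Set.BijOn (LagHist.psiFV (n := n)) Set.univ (LagHist.laguerreHistories n) ∧
    Set.BijOn (LagHist.psiYZL (n := n)) Set.univ (LagHist.laguerreHistories n) ∧
    Function.Bijective (LagHist.Psi (m := n + 1)) ∧
    LagHist.psiFV (n := n) = LagHist.psiYZL (n := n) ∘ LagHist.Psi (m := n + 1) := by
  have hFV := LagHist.psiFV_bijOn n
  have hcomp : LagHist.psiFV (n := n) = LagHist.psiYZL (n := n) ∘ LagHist.Psi (m := n + 1) :=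
    funext LagHist.psiFV_eq_psiYZL_Psi
  have hPsi : Function.Bijective (LagHist.Psi (m := n + 1)) := by
    -- `Psi` is the inner factor of the injective map `psiFV`, hence injective, and its domain is
    -- finite.
    refine Finite.injective_iff_bijective.1 (Function.Injective.of_comp (f := LagHist.psiYZL) ?_)
    rw [← hcomp]
    exact LagHist.psiFV_injective n
  refine ⟨hFV, ⟨?_, ?_, ?_⟩, hPsi, hcomp⟩
  · intro π _
    obtain ⟨σ, rfl⟩ := hPsi.2 π
    rw [← LagHist.psiFV_eq_psiYZL_Psi]
    exact LagHist.psiFV_mem_laguerreHistories σ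
  · apply Function.Injective.injOn
    intro π π' h
    obtain ⟨σ, rfl⟩ := hPsi.2 π
    obtain ⟨σ', rfl⟩ := hPsi.2 π'
    rw [← LagHist.psiFV_eq_psiYZL_Psi, ← LagHist.psiFV_eq_psiYZL_Psi] at h
    rw [LagHist.psiFV_injective n h]
  · intro x hx
    obtain ⟨σ, -, rfl⟩ := hFV.surjOn hx
    exact ⟨LagHist.Psi σ, Set.mem_univ _, (LagHist.psiFV_eq_psiYZL_Psi σ).symm⟩
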